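/- Conventions. Categories are locally small, filtered index categories are small, an ind-object $``\varinjlim"X_i$ is indexed by a small filtered category, with $\mathrm{Hom}(``\varinjlim"X_i,``\varinjlim"Y_j)=\varprojlim_i\varinjlim_j\mathrm{Hom}(X_i,Y_j)$, and $\mathrm{Pro}(\mathcal C)=\mathrm{Ind}(\mathcal C^{op})^{op}$. An exact category (in the sense of Quillen) is an additive category $\mathcal A$ with a class $\mathcal E$ of sequences $a'\xrightarrow{i}a\xrightarrow{j}a''$, where $i$ is a kernel of $j$ and $j$ is a cokernel of $i$ (such $i$ are called admissible monomorphisms, such $j$ admissible epimorphisms), such that: $\mathcal E$ is closed under isomorphism and contains all sequences $a'\to a'\oplus a''\to a''$; admissible monomorphisms and admissible epimorphisms are each closed under composition; the pullback of an admissible epimorphism along any morphism exists and is an admissible epimorphism; the pushout of an admissible monomorphism along any morphism exists and is an admissible monomorphism; if $f$ has a kernel in $\mathcal A$ and $fg$ is an admissible epimorphism for some $g$, then $f$ is an admissible epimorphism, and dually for admissible monomorphisms. Proposition. Let $(\mathcal A,\mathcal E)$ be an exact category. Let $\mathcal F$ be its abelian envelope, the category of additive functors $G:\mathcal A^{op}\to\mathbf{Ab}$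 (with values in abelian groups of a universe for which $\mathcal A$ is small) such that $0\to G(a'')\to G(a)\to G(a')$ is exact for every $a'\to a\to a''$ in $\mathcal E$, and let $h:\mathcal A\to\mathcal F$, $a\mapsto\mathrm{Hom}(-,a)$, be the Yoneda embedding. In $\mathrm{Ind}(\mathcal F)$ and $\mathrm{Pro}(\mathcal F)$, index categories are small for that same universe. Then: 1. The categories $\mathrm{Ind}(\mathcal F)$ and $\mathrm{Pro}(\mathcal F)$ are abelian. The functors $\mathrm{Ind}(h):\mathrm{Ind}(\mathcal A)\to\mathrm{Ind}(\mathcal F)$ and $\mathrm{Pro}(h):\mathrm{Pro}(\mathcal A)\to\mathrm{Pro}(\mathcal F)$ are fully faithful, and their essential images are closed under extensions. 2. The category $\mathrm{Ind}(\mathcal A)$, with the class of those sequences that $\mathrm{Ind}(h)$ sends to short exact sequences of $\mathrm{Ind}(\mathcal F)$, is an exact category. Likewise $\mathrm{Pro}(\mathcal A)$, with the class of those sequences that $\mathrm{Pro}(h)$ sends to short exact sequences of $\mathrm{Pro}(\mathcal F)$, is an exact category. 3. Every category obtained from $\mathcal A$ by applying $\mathrm{Ind}$ and $\mathrm{Pro}$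 finitely many times (at least once), in any order, is an exact category, for the class of sequences obtained by repeating the construction in part 2 at each step. In particular $\mathrm{Ind}\,\mathrm{Pro}(\mathcal A)$ and $\mathrm{Pro}\,\mathrm{Ind}(\mathcal A)$ are exact categories. -/

import Mathlib

open CategoryTheory Limits Opposite

universe v u v₁ u₁

namespace IndPro

section IndAdditive
variable {A : Type u} [Category.{v} A] [Preadditive A]

/-- The ind-object `X = “colim” Xᵢ` as a presheaf of abelian groups, `a ↦ colimᵢ Hom(a, Xᵢ)`. -/
noncomputable def addPresheaf (X : Ind A) : Aᵒᵖ ⥤ AddCommGrpCat.{v} :=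
  colimit (X.presentation.F ⋙ preadditiveYoneda)

/-- The presheaf of sets underlying `addPresheaf X` is the presheaf of sets `X`. -/
noncomputable def addPresheafForget (X : Ind A) :
    addPresheaf X ⋙ forget AddCommGrpCat.{v} ≅ (Ind.inclusion A).obj X :=
  (isColimitOfPreserves ((Functor.whiskeringRight Aᵒᵖ AddCommGrpCat.{v} (Type v)).obj
    (forget AddCommGrpCat.{v})) (colimit.isColimit (X.presentation.F ⋙ preadditiveYoneda))
    ).coconePointUniqueUpToIso X.presentation.isColimit

theorem addPresheaf_exists_rep (X : Ind A) (a : Aᵒᵖ) (x : (addPresheaf X).obj a) :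
    ∃ (i : X.presentation.I) (f : a.unop ⟶ X.presentation.F.obj i),
      (colimit.ι (X.presentation.F ⋙ preadditiveYoneda) i).app a f = x :=
  Concrete.isColimit_exists_rep _ (isColimitOfPreserves ((evaluation Aᵒᵖ AddCommGrpCat.{v}).obj a)
    (colimit.isColimit (X.presentation.F ⋙ preadditiveYoneda))) x

theorem addPresheaf_exists_rep₂ (X : Ind A) (a : Aᵒᵖ) (x y : (addPresheaf X).obj a) :
    ∃ (i : X.presentation.I) (f g : a.unop ⟶ X.presentation.F.obj i),
      (colimit.ι (X.presentation.F ⋙ preadditiveYoneda) i).app a f = x ∧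
      (colimit.ι (X.presentation.F ⋙ preadditiveYoneda) i).app a g = y := by
  obtain ⟨i, f, rfl⟩ := addPresheaf_exists_rep X a x
  obtain ⟨j, g, rfl⟩ := addPresheaf_exists_rep X a y
  refine ⟨IsFiltered.max i j, f ≫ X.presentation.F.map (IsFiltered.leftToMax i j),
    g ≫ X.presentation.F.map (IsFiltered.rightToMax i j), ?_, ?_⟩
  · exact congr($(congr_app (colimit.w (X.presentation.F ⋙ preadditiveYoneda)
      (IsFiltered.leftToMax i j)) a) f)
  · exact congr($(congr_app (colimit.w (X.presentation.F ⋙ preadditiveYoneda)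
      (IsFiltered.rightToMax i j)) a) g)

instance (X : Ind A) : (addPresheaf X).Additive where
  map_add {a b f g} := by
    ext x
    obtain ⟨i, h, rfl⟩ := addPresheaf_exists_rep X a x
    have key (k : a ⟶ b) : (addPresheaf X).map k
        ((colimit.ι (X.presentation.F ⋙ preadditiveYoneda) i).app a h) =
        (colimit.ι (X.presentation.F ⋙ preadditiveYoneda) i).app b (k.unop ≫ h) :=
      (congr($((colimit.ι (X.presentation.F ⋙ preadditiveYoneda) i).naturality k) h)).symm
    refine (key (f + g)).trans (Eq.trans ?_ (congrArg₂ (· + ·) (key f) (key g)).symm)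
    refine (congrArg _ (Preadditive.add_comp _ _ _ f.unop g.unop h)).trans ?_
    exact AddMonoidHom.map_add _ _ _

/-- Natural maps of sets from an ind-object to an additive presheaf of groups are additive. -/
theorem addPresheaf_hom_add {X : Ind A} {G : Aᵒᵖ ⥤ AddCommGrpCat.{v}} [G.Additive]
    (φ : addPresheaf X ⋙ forget AddCommGrpCat.{v} ⟶ G ⋙ forget AddCommGrpCat.{v}) (a : Aᵒᵖ)
    (x y : (addPresheaf X).obj a) :
    (φ.app a (x + y : (addPresheaf X).obj a) : G.obj a) =
      (φ.app a x : G.obj a) + (φ.app a y : G.obj a) := by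
  obtain ⟨i, f, g, rfl, rfl⟩ := addPresheaf_exists_rep₂ X a x y
  let F := X.presentation.F
  let ι := colimit.ι (X.presentation.F ⋙ preadditiveYoneda) i
  let t : G.obj (op (F.obj i)) := φ.app (op (F.obj i)) (ι.app (op (F.obj i)) (𝟙 (F.obj i)))
  have key (k : a.unop ⟶ F.obj i) : (φ.app a (ι.app a k) : G.obj a) = G.map k.op t := by
    have h1 := congr($(φ.naturality k.op) (ι.app (op (F.obj i)) (𝟙 (F.obj i))))
    have h2 := congr($(ι.naturality k.op) (𝟙 (F.obj i)))
    have h3 : ι.app a k = (addPresheaf X).map k.op (ι.app (op (F.obj i)) (𝟙 (F.obj i))) := by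
      refine Eq.trans ?_ h2
      exact congrArg (ι.app a) (Category.comp_id k).symm
    rw [h3]
    exact h1
  have h4 : ι.app a f + ι.app a g = ι.app a (f + g) := ((ι.app a).hom.map_add f g).symm
  change (φ.app a (ι.app a f + ι.app a g) : G.obj a) = φ.app a (ι.app a f) + φ.app a (ι.app a g)
  rw [h4, key, key, key, op_add, G.map_add]
  rfl

variable (A) in
/-- Ind-objects as presheaves of abelian groups. -/
noncomputable def indToAdd : Ind A ⥤ Aᵒᵖ ⥤ AddCommGrpCat.{v} where
  obj := addPresheaf
  map {X Y} f := 
    let φ := (addPresheafForget X).hom ≫ (Ind.inclusion A).map f ≫ (addPresheafForget Y).inv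
    { app a := AddCommGrpCat.ofHom
        (AddMonoidHom.mk' (fun x => φ.app a x) (addPresheaf_hom_add φ a))
      naturality a b k := by
        ext x
        exact congr($(φ.naturality k) x) }
  map_id X := by
    ext a x
    simp
  map_comp f g := by
    ext a x
    simp

/-- `indToAdd` is fully faithful. -/
noncomputable def indToAddFullyFaithful : (indToAdd A).FullyFaithful where
  preimage {X Y} φ := (Ind.inclusion.fullyFaithful (C := A)).preimage
    ((addPresheafForget X).inv ≫ Functor.whiskerRight φ (forget AddCommGrpCat.{v}) ≫
      (addPresheafForget Y).hom)
  map_preimage φ := by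
    ext a x
    simp [indToAdd]
    rfl
  preimage_map f := by
    apply (Ind.inclusion A).map_injective
    ext a x
    simp only [indToAdd, Functor.FullyFaithful.map_preimage, NatTrans.comp_app,
      Functor.whiskerRight_app, ConcreteCategory.comp_apply]
    refine (congr($((addPresheafForget _).inv_hom_id_app a) _)).trans ?_
    exact congrArg (((Ind.inclusion A).map f).app a)
      (congr($((addPresheafForget _).inv_hom_id_app a) x))

/-- The addition of morphisms of ind-objects of a preadditive category, induced by the addition
on `lim_i colim_j Hom(Xᵢ, Yⱼ)`. -/
noncomputable instance indPreadditive : Preadditive (Ind A) :=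
  Preadditive.ofFullyFaithful indToAddFullyFaithful

/-- The category of pro-objects, `Pro(C) = Ind(Cᵒᵖ)ᵒᵖ`. -/
abbrev Pro (C : Type u) [Category.{v} C] : Type (max u (v + 1)) := (Ind Cᵒᵖ)ᵒᵖ

end IndAdditive

section IndMap
variable {A : Type u} [Category.{v} A] {B : Type u₁} [Category.{max u v} B]

/-- The left Kan extension of presheaves along `h` (with a change of universe). -/
noncomputable def presheafMap (h : A ⥤ B) : (Aᵒᵖ ⥤ Type v) ⥤ (Bᵒᵖ ⥤ Type (max u v)) :=
  (Functor.whiskeringRight Aᵒᵖ (Type v) (Type (max u v))).obj uliftFunctor.{u, v} ⋙ h.op.lan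

/-- `presheafMap h` sends the presheaf represented by `a` to the one represented by `h a`. -/
noncomputable def presheafMapYoneda (h : A ⥤ B) : yoneda ⋙ presheafMap h ≅ h ⋙ yoneda :=
  Functor.isoWhiskerRight (show yoneda ⋙ (Functor.whiskeringRight Aᵒᵖ (Type v) (Type (max u v))).obj
      uliftFunctor.{u, v} ≅ uliftYoneda.{max u v} from
    NatIso.ofComponents fun X ↦ NatIso.ofComponents fun Y ↦
      (Equiv.ulift.trans Equiv.ulift.symm).toIso) h.op.lan ≪≫
    (Presheaf.compULiftYonedaIsoULiftYonedaCompLan.{u} h).symm ≪≫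
    Functor.isoWhiskerLeft h (NatIso.ofComponents fun X ↦ NatIso.ofComponents fun Y ↦
      Equiv.ulift.toIso)

instance (h : A ⥤ B) : PreservesColimitsOfSize.{v, v} (presheafMap h) := by
  have : PreservesColimitsOfSize.{v, v} ((Functor.whiskeringRight Aᵒᵖ (Type v) (Type (max u v))).obj uliftFunctor.{u, v}) := inferInstance
  have : PreservesColimitsOfSize.{v, v} (h.op.lan (H := Type (max u v))) := (h.op.lanAdjunction _).leftAdjoint_preservesColimits
  unfold presheafMap
  infer_instance

theorem isIndObject_presheafMap (h : A ⥤ B) (X : Ind A) :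
    IsIndObject ((presheafMap h).obj ((Ind.inclusion A).obj X)) := by
  let P := X.presentation
  let e : AsSmall.{u} P.I ≌ P.I := AsSmall.equiv.symm
  have hc := isColimitOfPreserves (presheafMap h) P.isColimit
  let i : e.functor ⋙ (P.F ⋙ h) ⋙ yoneda ≅ e.functor ⋙ (P.F ⋙ yoneda) ⋙ presheafMap h := 
    Functor.isoWhiskerLeft e.functor (Functor.isoWhiskerLeft P.F (presheafMapYoneda h).symm)
  have hc' := (IsColimit.precomposeHomEquiv i _).symm (hc.whiskerEquivalence e)
  have : IsFiltered (AsSmall.{u} P.I) := IsFiltered.of_equivalence e.symm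
  exact ⟨⟨{ I := AsSmall.{u} P.I, F := e.functor ⋙ P.F ⋙ h, ι := _, isColimit := hc' }⟩⟩

/-- The functor `Ind(h) : Ind(A) ⥤ Ind(B)`, `“colim” Xᵢ ↦ “colim” h(Xᵢ)`, obtained by restricting the
left Kan extension of presheaves along `h` to ind-objects. The index categories are `v`-small in
`Ind(A)` and `max u v`-small in `Ind(B)`. -/
noncomputable def indMap (h : A ⥤ B) : Ind A ⥤ Ind B :=
  ObjectProperty.lift _ (Ind.inclusion A ⋙ presheafMap h) (isIndObject_presheafMap h) ⋙
    (Ind.equivalence B).inverse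

/-- On underlying presheaves, `indMap h` is `presheafMap h`. -/
noncomputable def indMapInclusion (h : A ⥤ B) :
    indMap h ⋙ Ind.inclusion B ≅ Ind.inclusion A ⋙ presheafMap h :=
  Functor.isoWhiskerLeft (ObjectProperty.lift _ (Ind.inclusion A ⋙ presheafMap h) (isIndObject_presheafMap h))
    (Functor.isoWhiskerRight (Ind.equivalence B).counitIso (ObjectProperty.ι _))

/-- `indMap h` extends `h`. -/
noncomputable def indMapYoneda (h : A ⥤ B) : Ind.yoneda ⋙ indMap h ≅ h ⋙ Ind.yoneda :=
  (Ind.inclusion.fullyFaithful (C := B)).whiskeringRight _ |>.preimageIso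
   (Functor.isoWhiskerLeft Ind.yoneda (indMapInclusion h) ≪≫
    Functor.isoWhiskerRight Ind.yonedaCompInclusion (presheafMap h) ≪≫ presheafMapYoneda h ≪≫
    Functor.isoWhiskerLeft h Ind.yonedaCompInclusion.symm)

/-- `presheafMap h` is fully faithful if `h` is. -/
noncomputable def presheafMapFullyFaithful (h : A ⥤ B) [h.Full] [h.Faithful] :
    (presheafMap h).FullyFaithful :=
  (Functor.FullyFaithful.whiskeringRight (fullyFaithfulULiftFunctor.{u, v}) Aᵒᵖ).comp
    (h.op.lanAdjunction (Type (max u v))).fullyFaithfulLOfIsIsoUnit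

instance (h : A ⥤ B) [h.Full] [h.Faithful] : (presheafMap h).Full :=
  (presheafMapFullyFaithful h).full
instance (h : A ⥤ B) [h.Full] [h.Faithful] : (presheafMap h).Faithful :=
  (presheafMapFullyFaithful h).faithful

instance (h : A ⥤ B) [h.Full] [h.Faithful] : (indMap h).Full := by
  unfold indMap; infer_instance
instance (h : A ⥤ B) [h.Full] [h.Faithful] : (indMap h).Faithful := by
  unfold indMap; infer_instance

/-- The functor `Pro(h) : Pro(A) ⥤ Pro(B)`, `“lim” Xᵢ ↦ “lim” h(Xᵢ)`. -/
noncomputable def proMap (h : A ⥤ B) : Pro A ⥤ Pro B := (indMap h.op).op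

instance (h : A ⥤ B) [h.Full] [h.Faithful] : (proMap h).Full := by
  unfold proMap; infer_instance
instance (h : A ⥤ B) [h.Full] [h.Faithful] : (proMap h).Faithful := by
  unfold proMap; infer_instance

end IndMap

/-- `S.f` is a kernel of `S.g` and `S.g` is a cokernel of `S.f`, that is, `0 → X₁ → X₂ → X₃ → 0` is a
short exact sequence. -/
def IsKernelCokernelPair {A : Type u} [Category.{v} A] [HasZeroMorphisms A]
    (S : ShortComplex A) : Prop :=
  Nonempty (IsLimit (KernelFork.ofι S.f S.zero)) ∧
    Nonempty (IsColimit (CokernelCofork.ofπ S.g S.zero))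

theorem IsKernelCokernelPair.of_map {A : Type u} [Category.{v} A] [HasZeroMorphisms A]
    {B : Type u₁} [Category.{v₁} B] [HasZeroMorphisms B] (F : A ⥤ B) [F.Full] [F.Faithful]
    {S : ShortComplex A} (hS : IsKernelCokernelPair (S.map F)) : IsKernelCokernelPair S :=
  ⟨hS.1.map fun h ↦ isLimitOfReflects F
      ((KernelFork.isLimitMapConeEquiv (KernelFork.ofι S.f S.zero) F).symm h),
    hS.2.map fun h ↦ isColimitOfReflects F
      ((CokernelCofork.isColimitMapCoconeEquiv (CokernelCofork.ofπ S.g S.zero) F).symm h)⟩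

/-- A class of short exact sequences (kernel-cokernel pairs) in a preadditive category. -/
structure SequenceClass (A : Type u) [Category.{v} A] [Preadditive A] where
  mem : ShortComplex A → Prop
  isKernelCokernelPair {S : ShortComplex A} : mem S → IsKernelCokernelPair S

namespace SequenceClass
variable {A : Type u} [Category.{v} A] [Preadditive A] (E : SequenceClass A)

/-- `i` occurs as the first map of a sequence of the class. -/
def AdmissibleMono {a b : A} (i : a ⟶ b) : Prop :=
  ∃ (c : A) (j : b ⟶ c) (w : i ≫ j = 0), E.mem (ShortComplex.mk i j w)

/-- `j` occurs as the second map of a sequence of the class. -/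
def AdmissibleEpi {b c : A} (j : b ⟶ c) : Prop :=
  ∃ (a : A) (i : a ⟶ b) (w : i ≫ j = 0), E.mem (ShortComplex.mk i j w)

/-- Quillen's axioms: `(A, E)` is an exact category. -/
structure IsExact : Prop where
  hasFiniteBiproducts : HasFiniteBiproducts A
  of_iso {S T : ShortComplex A} : Nonempty (S ≅ T) → E.mem S → E.mem T
  split {a c : A} (b : BinaryBicone a c) :
    Nonempty b.IsBilimit → E.mem (ShortComplex.mk b.inl b.snd b.inl_snd)
  comp_epi {a b c : A} (f : a ⟶ b) (g : b ⟶ c) :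
    E.AdmissibleEpi f → E.AdmissibleEpi g → E.AdmissibleEpi (f ≫ g)
  comp_mono {a b c : A} (f : a ⟶ b) (g : b ⟶ c) :
    E.AdmissibleMono f → E.AdmissibleMono g → E.AdmissibleMono (f ≫ g)
  pullback_epi {a c d : A} (j : a ⟶ c) (f : d ⟶ c) : E.AdmissibleEpi j →
    ∃ (b : A) (j' : b ⟶ d) (f' : b ⟶ a), IsPullback f' j' j f ∧ E.AdmissibleEpi j'
  pushout_mono {a b c : A} (i : a ⟶ b) (f : a ⟶ c) : E.AdmissibleMono i →
    ∃ (d : A) (i' : c ⟶ d) (f' : b ⟶ d), IsPushout i f f' i' ∧ E.AdmissibleMono i'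
  obscure_epi {a b c : A} (g : a ⟶ b) (f : b ⟶ c) :
    HasKernel f → E.AdmissibleEpi (g ≫ f) → E.AdmissibleEpi f
  obscure_mono {a b c : A} (f : a ⟶ b) (g : b ⟶ c) :
    HasCokernel f → E.AdmissibleMono (f ≫ g) → E.AdmissibleMono f

/-- The additive functors `G : Aᵒᵖ ⥤ Ab` such that `0 → G a'' → G a → G a'` is exact for every
`0 → a' → a → a'' → 0` in `E`. -/
def leftExact : ObjectProperty (Aᵒᵖ ⥤ AddCommGrpCat.{max u v}) := fun G ↦
  G.Additive ∧ ∀ S : ShortComplex A, E.mem S →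
    Function.Injective (G.map S.g.op) ∧ Function.Exact (G.map S.g.op) (G.map S.f.op)

/-- The abelian envelope `F` of `(A, E)`. -/
abbrev Envelope : Type (max u v + 1) := E.leftExact.FullSubcategory

/-- The Yoneda embedding `a ↦ Hom(-, a)` with values in presheaves of abelian groups. -/
def yonedaUlift : A ⥤ Aᵒᵖ ⥤ AddCommGrpCat.{max u v} := 
  preadditiveYoneda ⋙ (Functor.whiskeringRight Aᵒᵖ AddCommGrpCat.{v} AddCommGrpCat.{max u v}).obj AddCommGrpCat.uliftFunctor.{u, v}

instance : (yonedaUlift (A := A)).Full := by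
  have := (AddCommGrpCat.uliftFunctorFullyFaithful.{u, v}.whiskeringRight Aᵒᵖ).full
  unfold yonedaUlift; infer_instance
instance : (yonedaUlift (A := A)).Faithful := by
  have := (AddCommGrpCat.uliftFunctorFullyFaithful.{u, v}.whiskeringRight Aᵒᵖ).faithful
  unfold yonedaUlift; infer_instance

theorem leftExact_yonedaUlift (a : A) : E.leftExact (yonedaUlift.obj a) := by
  refine ⟨?_, fun S hS ↦ ?_⟩
  · unfold yonedaUlift; dsimp; infer_instance
  · obtain ⟨-, ⟨hc⟩⟩ := E.isKernelCokernelPair hS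
    constructor
    · rintro ⟨x⟩ ⟨y⟩ h
      have h' : S.g ≫ x = S.g ≫ y := congrArg ULift.down h
      exact congrArg ULift.up (Cofork.IsColimit.hom_ext hc h')
    · rintro ⟨x⟩
      constructor
      · intro h
        have h' : S.f ≫ x = 0 := congrArg ULift.down h
        obtain ⟨y, hy⟩ := CokernelCofork.IsColimit.desc' hc x h'
        exact ⟨⟨y⟩, congrArg ULift.up hy⟩
      · rintro ⟨⟨y⟩, h⟩
        have h' : S.g ≫ y = x := congrArg ULift.down h
        have h0 (z : S.X₃ ⟶ a) : S.f ≫ S.g ≫ z = 0 := by rw [S.zero_assoc, zero_comp]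
        exact congrArg ULift.up ((congrArg (S.f ≫ ·) h'.symm).trans (h0 y))

/-- The Quillen embedding `A ⥤ F`, `a ↦ Hom(-, a)`. -/
def quillenEmbedding : A ⥤ E.Envelope :=
  E.leftExact.lift yonedaUlift E.leftExact_yonedaUlift

instance : E.quillenEmbedding.Full := by unfold quillenEmbedding; infer_instance
instance : E.quillenEmbedding.Faithful := by unfold quillenEmbedding; infer_instance

/-- The sequences of `Ind(A)` that become short exact in `Ind(F)`, for the envelope `F`. -/
def ind : SequenceClass (Ind A) where
  mem S := IsKernelCokernelPair (S.map (indMap E.quillenEmbedding))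
  isKernelCokernelPair hS := hS.of_map _

/-- The sequences of `Pro(A)` that become short exact in `Pro(F)`, for the envelope `F`. -/
def pro : SequenceClass (Pro A) where
  mem S := IsKernelCokernelPair (S.map (proMap E.quillenEmbedding))
  isKernelCokernelPair hS := hS.of_map _

end SequenceClass

/-- A preadditive category with a class of short exact sequences. -/
structure CatWithSequences where
  carrier : Type u
  [category : Category.{v} carrier]
  [preadditive : Preadditive carrier]
  seq : SequenceClass carrier

attribute [instance] CatWithSequences.category CatWithSequences.preadditive

/-- The two operations `Ind` and `Pro`. -/
inductive Step where
  | ind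
  | pro

/-- Apply `Ind` or `Pro` to a category with a class of short exact sequences. -/
noncomputable def CatWithSequences.apply (C : CatWithSequences.{v, u}) :
    Step → CatWithSequences.{v, max u (v + 1)}
  | .ind => { carrier := Ind C.carrier, seq := C.seq.ind }
  | .pro => { carrier := Pro C.carrier, seq := C.seq.pro }

/-- The iterated ind/pro-categories. The step `s` is applied first and the head of the list is
applied last: `C.iterated .pro [.ind]` is `Ind(Pro(C))`. -/
noncomputable def CatWithSequences.iterated (C : CatWithSequences.{v, u}) (s : Step) :
    List Step → CatWithSequences.{v, max u (v + 1)}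
  | [] => C.apply s
  | t :: l => (C.iterated s l).apply t

end IndPro

open IndPro

/-!
Covering the objects of `A` by admissible epimorphisms gives a Grothendieck topology whose additive
sheaves are the left exact functors, so the envelope `F` is abelian as a category of sheaves closed
under subobjects, quotients and finite products. Moreover `A` is closed under extensions in `F`: an
epimorphism onto `h c` splits along an admissible epimorphism, hence an extension of `h c` by `h a`
is a pushout of an admissible sequence, and such pushouts exist in `A`.

Extension-closedness passes to ind-objects. By compactness of `Z ∈ F` in `Ind(F)`, an extension of
`Z` by `colim Xᵢ` is the pushout of an extension in `F` along a map into some `Xᵢ`, and therefore a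
filtered colimit of extensions of `Z` by the later `Xᵢ`; the case of general `Z` reduces to this
one by pulling back along compact objects. Pro-objects follow by duality. Finally, a full
subcategory closed under extensions in an abelian category is exact, so the construction iterates.
-/

universe w

namespace IndPro

section ShortExact

theorem IsKernelCokernelPair.op {D : Type u} [Category.{v} D] [HasZeroMorphisms D]
    {S : ShortComplex D} (h : IsKernelCokernelPair S) : IsKernelCokernelPair S.op := by
  obtain ⟨⟨hf⟩, ⟨hg⟩⟩ := h
  exact ⟨⟨CokernelCofork.IsColimit.ofπOp _ _ hg⟩, ⟨KernelFork.IsLimit.ofιOp _ _ hf⟩⟩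

theorem IsKernelCokernelPair.unop {D : Type u} [Category.{v} D] [HasZeroMorphisms D]
    {S : ShortComplex Dᵒᵖ} (h : IsKernelCokernelPair S) : IsKernelCokernelPair S.unop := by
  obtain ⟨⟨hf⟩, ⟨hg⟩⟩ := h
  exact ⟨⟨CokernelCofork.IsColimit.ofπUnop _ _ hg⟩, ⟨KernelFork.IsLimit.ofιUnop _ _ hf⟩⟩

variable {D : Type u} [Category.{v} D] [Abelian D]

theorem isKernelCokernelPair_iff_shortExact (S : ShortComplex D) :
    IsKernelCokernelPair S ↔ S.ShortExact := by
  constructor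
  · rintro ⟨⟨hf⟩, ⟨hg⟩⟩
    have : Mono S.f := mono_of_isLimit_fork hf
    have : Epi S.g := epi_of_isColimit_cofork hg
    exact ⟨S.exact_of_f_is_kernel hf⟩
  · intro h
    exact ⟨⟨h.fIsKernel⟩, ⟨h.gIsCokernel⟩⟩

theorem shortExact_kernelSequence {X Y : D} (f : X ⟶ Y) [Epi f] :
    (ShortComplex.kernelSequence f).ShortExact :=
  { exact := ShortComplex.kernelSequence_exact f
    mono_f := inferInstanceAs (Mono (kernel.ι f))
    epi_g := ‹_› }

theorem shortExact_of_forall_lift {K X Y : D} {k : K ⟶ X} {f : X ⟶ Y} (w : k ≫ f = 0) [Mono k]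
    [Epi f] (h : ∀ {T : D} (t : T ⟶ X), t ≫ f = 0 → ∃ s : T ⟶ K, s ≫ k = t) :
    (ShortComplex.mk k f w).ShortExact :=
  { exact := ShortComplex.exact_of_f_is_kernel _ (KernelFork.IsLimit.ofι' k w
      fun t ht ↦ ⟨(h t ht).choose, (h t ht).choose_spec⟩)
    mono_f := ‹_›
    epi_g := ‹_› }

theorem shortExact_of_isPullback {P X Y Z K : D} {fst : P ⟶ X} {snd : P ⟶ Y} {f : X ⟶ Z}
    {g : Y ⟶ Z} (h : IsPullback fst snd f g) {k : K ⟶ X} {w : k ≫ f = 0}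
    (hk : (ShortComplex.mk k f w).ShortExact) :
    (ShortComplex.mk (h.lift k 0 (by simp [w])) snd (by simp)).ShortExact := by
  have : Mono k := hk.mono_f
  have : Epi f := hk.epi_g
  have : Epi snd := MorphismProperty.of_isPullback (P := .epimorphisms D) h ‹_›
  have : Mono (h.lift k 0 (by simp [w])) :=
    mono_of_mono_fac (h.lift_fst k 0 (by simp [w]))
  refine shortExact_of_forall_lift _ fun t ht ↦ ?_
  obtain ⟨s, hs⟩ := hk.exact.lift' (t ≫ fst) (by simp [h.w, reassoc_of% ht])
  exact ⟨s, h.hom_ext (by simpa using hs) (by simpa using ht.symm)⟩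

theorem shortExact_of_isPushout {P X Y Z C : D} {f : Z ⟶ X} {g : Z ⟶ Y} {inl : X ⟶ P}
    {inr : Y ⟶ P} (h : IsPushout f g inl inr) {c : X ⟶ C} {w : f ≫ c = 0}
    (hc : (ShortComplex.mk f c w).ShortExact) :
    (ShortComplex.mk inr (h.desc c 0 (by simp [w])) (by simp)).ShortExact := by
  have hs := (shortExact_of_isPullback h.op.flip hc.op).unop
  have hdesc : (h.op.flip.lift c.op 0 (by simp [← op_comp, w])).unop =
      h.desc c 0 (by simp [w]) := by
    apply h.hom_ext <;> apply Quiver.Hom.op_inj <;> simp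
  simp only [← hdesc]
  exact hs

theorem isPushout_of_shortExact {P X Y Z C : D} {f : Z ⟶ X} {g : Z ⟶ Y} {inl : X ⟶ P}
    {inr : Y ⟶ P} (sq : CommSq f g inl inr) {c : X ⟶ C} {w : f ≫ c = 0}
    (hc : (ShortComplex.mk f c w).ShortExact) {c' : P ⟶ C} {w' : inr ≫ c' = 0}
    (hc' : (ShortComplex.mk inr c' w').ShortExact) (h : inl ≫ c' = c) :
    IsPushout f g inl inr := by
  have hQ := IsPushout.of_hasPushout f g
  let φ : ShortComplex.mk (pushout.inr f g) (hQ.desc c 0 (by simp [w])) (by simp) ⟶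
      ShortComplex.mk inr c' w' :=
    { τ₁ := 𝟙 Y
      τ₂ := hQ.desc inl inr sq.w
      τ₃ := 𝟙 C
      comm₂₃ := hQ.hom_ext (by simp [h]) (by simp [w']) }
  have : IsIso φ.τ₁ := inferInstanceAs (IsIso (𝟙 Y))
  have : IsIso φ.τ₃ := inferInstanceAs (IsIso (𝟙 C))
  have : IsIso φ.τ₂ :=
    ShortComplex.isIso₂_of_shortExact_of_isIso₁₃ φ (shortExact_of_isPushout hQ hc) hc'
  exact hQ.of_iso (Iso.refl _) (Iso.refl _) (Iso.refl _) (asIso φ.τ₂) (by simp) (by simp)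
    (by simp [φ]) (by simp [φ])

theorem isClosedUnderExtensions_op_essImage {B : Type u₁} [Category.{v₁} B] (F : B ⥤ D)
    [F.essImage.IsClosedUnderExtensions] : F.op.essImage.IsClosedUnderExtensions where
  prop_X₂_of_shortExact {S} hS := fun ⟨a, ⟨ea⟩⟩ ⟨c, ⟨ec⟩⟩ ↦ by
    obtain ⟨b, ⟨e⟩⟩ := F.essImage.prop_X₂_of_shortExact hS.unop ⟨c.unop, ⟨ec.unop.symm⟩⟩
      ⟨a.unop, ⟨ea.unop.symm⟩⟩
    exact ⟨.op b, ⟨e.op.symm⟩⟩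

end ShortExact

section KernelOfPullback

variable {B : Type u} [Category.{v} B] [Preadditive B] {D : Type u₁} [Category.{v₁} D]
  [Preadditive D]

/-- The kernel of `f` is a retract of the pullback of `f` along any `g ≫ f`, and additive functors
preserve retracts. -/
theorem isLimit_map_kernel_of_isPullback_map (F : B ⥤ D) [F.Additive] {a b c P : B} {g : a ⟶ b}
    {f : b ⟶ c} [HasKernel f] {p₁ : P ⟶ a} {p₂ : P ⟶ b} (hP : IsPullback p₁ p₂ (g ≫ f) f)
    (hPF : IsPullback (F.map p₁) (F.map p₂) (F.map (g ≫ f)) (F.map f)) :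
    Nonempty (IsLimit (KernelFork.ofι (F.map (kernel.ι f))
      (by rw [← F.map_comp, kernel.condition, F.map_zero] : _ ≫ F.map f = 0))) := by
  let k : kernel f ⟶ P := hP.lift 0 (kernel.ι f) (by simp)
  let r : P ⟶ kernel f := kernel.lift f (p₂ - p₁ ≫ g) (by simp [hP.w])
  have hk₁ : F.map k ≫ F.map p₁ = 0 := by rw [← F.map_comp, hP.lift_fst, F.map_zero]
  have hk₂ : F.map k ≫ F.map p₂ = F.map (kernel.ι f) := by rw [← F.map_comp, hP.lift_snd]
  have hr : F.map r ≫ F.map (kernel.ι f) = F.map p₂ - F.map p₁ ≫ F.map g := by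
    rw [← F.map_comp, kernel.lift_ι, F.map_sub, F.map_comp]
  have hkr : F.map k ≫ F.map r = 𝟙 _ := by
    rw [← F.map_comp, ← F.map_id]
    congr 1
    simp [← cancel_mono (kernel.ι f), k, r]
  have : Mono (F.map (kernel.ι f)) := Preadditive.mono_of_cancel_zero _ fun x hx ↦ by
    have hxk : x ≫ F.map k = 0 := hPF.hom_ext (by simp [hk₁]) (by simp [hk₂, hx])
    rw [← Category.comp_id x, ← hkr, reassoc_of% hxk, zero_comp]
  refine ⟨KernelFork.IsLimit.ofι' _ _ fun x hx ↦ ⟨hPF.lift 0 x (by simp [hx]) ≫ F.map r, ?_⟩⟩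
  simp [hr]

end KernelOfPullback

namespace SequenceClass

variable {B : Type u} [Category.{v} B] [Preadditive B]

/-- The class `E`, read in the opposite category. -/
def opposite (E : SequenceClass B) : SequenceClass Bᵒᵖ where
  mem S := E.mem S.unop
  isKernelCokernelPair h := (E.isKernelCokernelPair h).op

theorem admissibleEpi_opposite_op_iff (E : SequenceClass B) {a b : B} (i : a ⟶ b) :
    E.opposite.AdmissibleEpi i.op ↔ E.AdmissibleMono i :=
  ⟨fun ⟨c, j, w, h⟩ ↦ ⟨c.unop, j.unop, congrArg Quiver.Hom.unop w, h⟩,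
    fun ⟨c, j, w, h⟩ ↦ ⟨.op c, j.op, congrArg Quiver.Hom.op w, h⟩⟩

section

variable {D : Type u₁} [Category.{v₁} D] [Abelian D] {E : SequenceClass B} {F : B ⥤ D}

theorem mem_iff_shortExact [F.PreservesZeroMorphisms]
    (hE : ∀ S, E.mem S ↔ IsKernelCokernelPair (S.map F)) (S : ShortComplex B) :
    E.mem S ↔ (S.map F).ShortExact :=
  (hE S).trans (isKernelCokernelPair_iff_shortExact _)

variable [F.Additive] (hE : ∀ S, E.mem S ↔ IsKernelCokernelPair (S.map F))

include hE

theorem AdmissibleEpi.epi_map {b c : B} {j : b ⟶ c} (hj : E.AdmissibleEpi j) : Epi (F.map j) := by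
  obtain ⟨a, i, w, h⟩ := hj
  exact ((mem_iff_shortExact hE _).1 h).epi_g

variable [F.Full] [F.Faithful]

theorem admissibleEpi_of_shortExact {b c : B} {j : b ⟶ c} {K : D} {k : K ⟶ F.obj b}
    {w : k ≫ F.map j = 0} (h : (ShortComplex.mk k (F.map j) w).ShortExact) (hK : F.essImage K) :
    E.AdmissibleEpi j := by
  obtain ⟨a, ⟨e⟩⟩ := hK
  refine ⟨a, F.preimage (e.hom ≫ k), F.map_injective (by simp [w]), ?_⟩
  rw [mem_iff_shortExact hE]
  refine ShortComplex.shortExact_of_iso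
    (ShortComplex.isoMk e.symm (Iso.refl (F.obj b)) (Iso.refl (F.obj c)) ?_ ?_) h
  · exact (by simp : e.inv ≫ F.map (F.preimage (e.hom ≫ k)) = k ≫ 𝟙 _)
  · exact (Category.id_comp _).trans (Category.comp_id _).symm

variable [F.essImage.IsClosedUnderExtensions]

theorem AdmissibleEpi.comp {a b c : B} {f : a ⟶ b} {g : b ⟶ c} (hf : E.AdmissibleEpi f)
    (hg : E.AdmissibleEpi g) : E.AdmissibleEpi (f ≫ g) := by
  have : Epi (F.map (f ≫ g)) := by
    have := hf.epi_map hE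
    have := hg.epi_map hE
    rw [F.map_comp]
    infer_instance
  obtain ⟨x, i, w, hf⟩ := hf
  obtain ⟨y, l, w', hg⟩ := hg
  rw [mem_iff_shortExact hE] at hf
  have hlg : F.map l ≫ F.map g = 0 := by rw [← F.map_comp, w', F.map_zero]
  have hg : (ShortComplex.mk (F.map l) (F.map g) hlg).ShortExact := (mem_iff_shortExact hE _).1 hg
  have : Mono (F.map l) := hg.mono_f
  let k := pullback.fst (F.map f) (F.map l)
  have hk : k ≫ F.map (f ≫ g) = 0 := by
    rw [F.map_comp, pullback.condition_assoc, hlg, comp_zero]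
  have hker : (ShortComplex.mk k (F.map (f ≫ g)) hk).ShortExact := by
    refine shortExact_of_forall_lift _ fun t ht ↦ ?_
    obtain ⟨s, hs⟩ := hg.exact.lift' (t ≫ F.map f) (by simpa using ht)
    exact ⟨pullback.lift t s hs.symm, pullback.lift_fst _ _ _⟩
  exact admissibleEpi_of_shortExact hE hker (F.essImage.prop_X₂_of_shortExact
    (shortExact_of_isPullback (.of_hasPullback (F.map f) (F.map l)) hf)
    (F.obj_mem_essImage _) (F.obj_mem_essImage _))

theorem AdmissibleEpi.exists_isPullback_map {a c d : B} {j : a ⟶ c} (hj : E.AdmissibleEpi j)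
    (f : d ⟶ c) : ∃ (b : B) (j' : b ⟶ d) (f' : b ⟶ a),
      IsPullback (F.map f') (F.map j') (F.map j) (F.map f) ∧ E.AdmissibleEpi j' := by
  obtain ⟨x, i, w, hj⟩ := hj
  rw [mem_iff_shortExact hE] at hj
  have hP := IsPullback.of_hasPullback (F.map j) (F.map f)
  obtain ⟨b, ⟨e⟩⟩ := F.essImage.prop_X₂_of_shortExact (shortExact_of_isPullback hP hj)
    (F.obj_mem_essImage _) (F.obj_mem_essImage _)
  have h : IsPullback (F.map (F.preimage (e.hom ≫ pullback.fst _ _)))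
      (F.map (F.preimage (e.hom ≫ pullback.snd _ _))) (F.map j) (F.map f) :=
    hP.of_iso e.symm (Iso.refl _) (Iso.refl _) (Iso.refl _) (by simp) (by simp) (by simp) (by simp)
  exact ⟨b, _, _, h, admissibleEpi_of_shortExact hE (shortExact_of_isPullback h hj)
    (F.obj_mem_essImage _)⟩

theorem AdmissibleEpi.exists_isPullback {a c d : B} {j : a ⟶ c} (hj : E.AdmissibleEpi j)
    (f : d ⟶ c) : ∃ (b : B) (j' : b ⟶ d) (f' : b ⟶ a), IsPullback f' j' j f ∧
      E.AdmissibleEpi j' := by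
  obtain ⟨b, j', f', h, hj'⟩ := hj.exists_isPullback_map hE f
  exact ⟨b, j', f', .of_map F (F.map_injective (by simpa using h.w)) h, hj'⟩

theorem AdmissibleEpi.of_comp {a b c : B} {g : a ⟶ b} {f : b ⟶ c} [HasKernel f]
    (hgf : E.AdmissibleEpi (g ≫ f)) : E.AdmissibleEpi f := by
  have : Epi (F.map f) := by
    have := hgf.epi_map hE
    exact epi_of_epi_fac (F.map_comp g f).symm
  obtain ⟨P, p₂, p₁, hPF, -⟩ := hgf.exists_isPullback_map hE f
  have hP : IsPullback p₁ p₂ (g ≫ f) f := .of_map F (F.map_injective (by simpa using hPF.w)) hPF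
  obtain ⟨hker⟩ := isLimit_map_kernel_of_isPullback_map F hP hPF
  have : Mono (F.map (kernel.ι f)) := mono_of_isLimit_fork hker
  exact admissibleEpi_of_shortExact hE (k := F.map (kernel.ι f))
    (w := by rw [← F.map_comp, kernel.condition, F.map_zero])
    { exact := ShortComplex.exact_of_f_is_kernel _ hker
      mono_f := ‹_›
      epi_g := ‹_› }
    (F.obj_mem_essImage _)

end

/-- Only the axioms about admissible epimorphisms need an argument: the others are the same
statements for `F.op`. -/
theorem isExact_of_isClosedUnderExtensions [HasFiniteBiproducts B] {D : Type u₁}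
    [Category.{v₁} D] [Abelian D] {E : SequenceClass B} {F : B ⥤ D} [F.Full] [F.Faithful]
    [F.Additive] [F.essImage.IsClosedUnderExtensions]
    (hE : ∀ S, E.mem S ↔ IsKernelCokernelPair (S.map F)) : E.IsExact := by
  have hE' (S : ShortComplex Bᵒᵖ) : E.opposite.mem S ↔ IsKernelCokernelPair (S.map F.op) :=
    (hE S.unop).trans ⟨fun h ↦ h.op, fun h ↦ h.unop⟩
  have := isClosedUnderExtensions_op_essImage F
  exact
  { hasFiniteBiproducts := inferInstance
    of_iso := fun ⟨e⟩ hS ↦ by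
      rw [mem_iff_shortExact hE] at hS ⊢
      exact ShortComplex.shortExact_of_iso (F.mapShortComplex.mapIso e) hS
    split := fun b ⟨hb⟩ ↦ by
      rw [mem_iff_shortExact hE]
      have s : (ShortComplex.mk b.inl b.snd b.inl_snd).Splitting :=
        { r := b.fst, s := b.inr, id := IsBilimit.binary_total hb }
      exact (s.map F).shortExact
    comp_epi := fun _ _ hf hg ↦ hf.comp hE hg
    comp_mono := fun _ _ hf hg ↦ by
      rw [← admissibleEpi_opposite_op_iff] at hf hg ⊢
      exact hg.comp hE' hf
    pullback_epi := fun _ f hj ↦ hj.exists_isPullback hE f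
    pushout_mono := fun i f hi ↦ by
      rw [← admissibleEpi_opposite_op_iff] at hi
      obtain ⟨b, j', f', h, hj'⟩ := hi.exists_isPullback hE' f.op
      exact ⟨b.unop, j'.unop, f'.unop, h.unop.flip, (admissibleEpi_opposite_op_iff _ _).1 hj'⟩
    obscure_epi := fun _ _ _ h ↦ h.of_comp hE
    obscure_mono := fun f g _ h ↦ by
      have : HasKernel f.op :=
        ⟨⟨_, CokernelCofork.IsColimit.ofπOp _ (cokernel.condition f) (cokernelIsCokernel f)⟩⟩
      rw [← admissibleEpi_opposite_op_iff] at h ⊢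
      exact AdmissibleEpi.of_comp (g := g.op) hE' h }

end SequenceClass

section IndAbelian

instance {B : Type u} [Category.{v} B] [Preadditive B] [HasFiniteBiproducts B] :
    HasFiniteBiproducts (Ind B) := by
  have : HasFiniteProducts (Ind B) :=
    ⟨fun n ↦ hasLimitsOfShape_of_equivalence (Discrete.equivalence (Equiv.ulift.{v} (α := Fin n)))⟩
  exact HasFiniteBiproducts.of_hasFiniteProducts

theorem additive_of_fullyFaithful {B : Type u} [Category.{v} B] [Preadditive B]
    [HasBinaryBiproducts B] {D : Type u₁} [Category.{v₁} D] [Preadditive D] (F : B ⥤ D) [F.Full]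
    [F.Faithful] : F.Additive := by
  have h : (inferInstance : Preadditive B) = .ofFullyFaithful (.ofFullyFaithful F) :=
    Subsingleton.elim _ _
  refine ⟨fun {X Y f g} ↦ ?_⟩
  exact (congrArg (fun p : Preadditive B ↦ F.map ((p.homGroup X Y).add f g)) h).trans
    ((Functor.FullyFaithful.ofFullyFaithful F).map_preimage _)

instance {B : Type u} [Category.{v} B] [Preadditive B] [HasBinaryBiproducts B] :
    (Ind.yoneda (C := B)).Additive :=
  additive_of_fullyFaithful _

variable {B : Type u} [Category.{v} B] [Abelian B]

theorem isIso_coimageImageComparison_ind {X Y : Ind B} (f : X ⟶ Y) :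
    IsIso (Abelian.coimageImageComparison f) := by
  obtain ⟨I, _, _, F, G, φ, ⟨e⟩⟩ := Ind.exists_nonempty_arrow_mk_iso_ind_lim (f := f)
  have : HasZeroObject (Ind B) := hasZeroObject_of_hasTerminal_object
  have : (Ind.lim (C := B) I).PreservesZeroMorphisms := inferInstance
  let e' : Arrow.mk (Abelian.coimageImageComparison f) ≅
      Arrow.mk (Abelian.coimageImageComparison ((Ind.lim I).map φ)) :=
    Abelian.coimageImageComparisonFunctor.mapIso e
  rw [Arrow.isIso_iff_isIso_of_isIso e'.hom,
    Arrow.isIso_iff_isIso_of_isIso (Abelian.PreservesCoimageImageComparison.iso (Ind.lim I) φ).inv]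
  infer_instance

/-- The category of ind-objects of an abelian category is abelian; its underlying preadditive
structure is `indPreadditive`. -/
noncomputable instance indAbelian : Abelian (Ind B) :=
  have := @isIso_coimageImageComparison_ind B _ _
  .ofCoimageImageComparisonIsIso

end IndAbelian

section Compactness

/-- The Yoneda lemma for ind-objects: morphisms from an object `b` of `B` to an ind-object are the
values of its presheaf at `b`. It makes the objects of `B` compact in `Ind B`. -/
noncomputable def coyonedaIndYonedaIso {B : Type u} [Category.{v} B] (b : B) :
    coyoneda.obj (op (Ind.yoneda.obj b)) ≅ Ind.inclusion B ⋙ (evaluation Bᵒᵖ (Type v)).obj (op b) :=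
  NatIso.ofComponents
    (fun X ↦ ((Ind.inclusion.fullyFaithful.homEquiv.trans
      ((Ind.yonedaCompInclusion.app b).homFromEquiv)).trans yonedaEquiv).toIso)
    fun f ↦ by ext; simp [yonedaEquiv, Functor.FullyFaithful.homEquiv]

instance {B : Type u₁} [Category.{max u v} B] (b : B) :
    IsFinitelyPresentable.{v} (Ind.yoneda.obj b) := by
  rw [isFinitelyPresentable_iff_preservesFilteredColimitsOfSize]
  have : PreservesFilteredColimitsOfSize.{max u v, max u v}
      (coyoneda.obj (op (Ind.yoneda.obj b))) :=
    ⟨fun _ _ _ ↦ preservesColimitsOfShape_of_natIso (coyonedaIndYonedaIso b).symm⟩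
  exact preservesFilteredColimitsOfSize_shrink.{v, u, v, u} _

theorem exists_map_yoneda_comp_eq {B : Type u₁} [Category.{max u v} B] {K : Type v}
    [SmallCategory K] [IsFiltered K] {G : K ⥤ B} {X : Ind B}
    {a : G ⋙ Ind.yoneda ⟶ (Functor.const K).obj X} (ha : IsColimit (Cocone.mk X a)) {b : B}
    (t : Ind.yoneda.obj b ⟶ X) :
    ∃ (k : K) (s : b ⟶ G.obj k), Ind.yoneda.map s ≫ a.app k = t := by
  obtain ⟨k, s, hs⟩ := IsFinitelyPresentable.exists_hom_of_isColimit ha t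
  exact ⟨k, Ind.yoneda.preimage s, by simpa using hs⟩

theorem exists_comp_map_eq {B : Type u₁} [Category.{max u v} B] {K : Type v}
    [SmallCategory K] [IsFiltered K] {G : K ⥤ B} {X : Ind B}
    {a : G ⋙ Ind.yoneda ⟶ (Functor.const K).obj X} (ha : IsColimit (Cocone.mk X a)) {b : B}
    {i j : K} {s : b ⟶ G.obj i} {t : b ⟶ G.obj j}
    (h : Ind.yoneda.map s ≫ a.app i = Ind.yoneda.map t ≫ a.app j) :
    ∃ (k : K) (f : i ⟶ k) (g : j ⟶ k), s ≫ G.map f = t ≫ G.map g := by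
  obtain ⟨k, f, g, hfg⟩ := IsFinitelyPresentable.exists_eq_of_isColimit ha _ _ h
  exact ⟨k, f, g, Ind.yoneda.map_injective (by simpa using hfg)⟩

theorem exists_colimit_presentation {B : Type u} [Category.{v} B] (X : Ind B) :
    ∃ (K : Type v) (_ : SmallCategory K) (_ : IsFiltered K) (G : K ⥤ B)
      (a : G ⋙ Ind.yoneda ⟶ (Functor.const K).obj X), Nonempty (IsColimit (Cocone.mk X a)) := by
  let e := Ind.colimitPresentationCompYoneda X
  exact ⟨_, _, inferInstance, X.presentation.F,
    (colimit.cocone _).ι ≫ (Functor.const _).map e.hom,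
    ⟨(colimit.isColimit _).ofIsoColimit (Cocone.ext e)⟩⟩

end Compactness

section Density

theorem isDense_of_comp {C D E : Type*} [Category* C] [Category* D] [Category* E] (F : C ⥤ D)
    (G : D ⥤ E) [G.Full] [G.Faithful] [(F ⋙ G).IsDense] : F.IsDense where
  isDenseAt Y := ⟨isColimitOfReflects G
    ((((F ⋙ G).denseAt (G.obj Y)).whiskerEquivalence
      (CostructuredArrow.post F G Y).asEquivalence).ofIsoColimit
        (Cocone.ext (Iso.refl _) fun j ↦ by
          change (𝟙 _ ≫ G.map j.hom) ≫ 𝟙 _ = G.map (𝟙 _ ≫ j.hom)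
          simp))⟩

instance {B : Type u} [Category.{v} B] : (Ind.yoneda (C := B)).IsDense :=
  have : (Ind.yoneda ⋙ Ind.inclusion B).IsDense := .of_iso Ind.yonedaCompInclusion.symm
  isDense_of_comp _ (Ind.inclusion B)

end Density

section EssentialImage

variable {A : Type u} [Category.{v} A] {B : Type u₁} [Category.{max u v} B]

instance {K : Type v} [SmallCategory K] [IsFiltered K] (h : A ⥤ B) :
    PreservesColimitsOfShape K (indMap h) := by
  have : PreservesFilteredColimitsOfSize.{v, v} (Ind.inclusion B) :=
    have : PreservesFilteredColimitsOfSize.{max u v, max u v} (Ind.inclusion B) :=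
      ⟨fun _ _ _ ↦ inferInstance⟩
    preservesFilteredColimitsOfSize_shrink.{v, u, v, u} _
  have : PreservesColimitsOfShape K (Ind.inclusion B) :=
    PreservesFilteredColimitsOfSize.preserves_filtered_colimits _
  have : PreservesColimitsOfShape K (indMap h ⋙ Ind.inclusion B) :=
    preservesColimitsOfShape_of_natIso (indMapInclusion h).symm
  exact preservesColimitsOfShape_of_reflects_of_preserves _ (Ind.inclusion B)

theorem mem_essImage_indMap_iff (h : A ⥤ B) (X : Ind B) :
    (indMap h).essImage X ↔ ∃ (K : Type v) (_ : SmallCategory K) (_ : IsFiltered K) (P : K ⥤ A)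
      (a : (P ⋙ h) ⋙ Ind.yoneda ⟶ (Functor.const K).obj X),
        Nonempty (IsColimit (Cocone.mk X a)) := by
  constructor
  · rintro ⟨X₀, ⟨e⟩⟩
    obtain ⟨K, _, _, P, a, ⟨ha⟩⟩ := exists_colimit_presentation X₀
    let i : (P ⋙ h) ⋙ Ind.yoneda ≅ (P ⋙ Ind.yoneda) ⋙ indMap h :=
      Functor.isoWhiskerLeft P (indMapYoneda h).symm
    exact ⟨K, _, ‹_›, P, i.hom ≫ ((indMap h).mapCocone ⟨X₀, a⟩).ι ≫ (Functor.const K).map e.hom,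
      ⟨((IsColimit.precomposeHomEquiv i _).symm
        (isColimitOfPreserves (indMap h) ha)).ofIsoColimit (Cocone.ext e)⟩⟩
  · rintro ⟨K, _, _, P, a, ⟨ha⟩⟩
    exact ⟨colimit (P ⋙ Ind.yoneda), ⟨(isColimitOfPreserves (indMap h)
      (colimit.isColimit (P ⋙ Ind.yoneda))).coconePointsIsoOfNatIso ha
        (Functor.isoWhiskerLeft P (indMapYoneda h))⟩⟩

theorem mem_essImage_indMap (h : A ⥤ B) [h.Full] [h.Faithful] {Y : Ind B} {ι : Type v}
    (y : ι → A) (p : ∀ i, Ind.yoneda.obj (h.obj (y i)) ⟶ Y)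
    (H : ∀ (b : B) (t : Ind.yoneda.obj b ⟶ Y),
      ∃ (i : ι) (g : b ⟶ h.obj (y i)), Ind.yoneda.map g ≫ p i = t) :
    (indMap h).essImage Y := by
  let pre := CostructuredArrow.pre h Ind.yoneda Y
  have hpre (d : CostructuredArrow Ind.yoneda Y) : ∃ i,
      Nonempty (d ⟶ pre.obj (CostructuredArrow.mk (S := h ⋙ Ind.yoneda) (p i))) := by
    obtain ⟨i, g, hg⟩ := H d.left d.hom
    exact ⟨i, ⟨CostructuredArrow.homMk g hg⟩⟩
  have hpre' (d : CostructuredArrow Ind.yoneda Y) : ∃ k, Nonempty (d ⟶ pre.obj k) :=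
    (hpre d).imp' _ fun _ ↦ id
  have : IsFiltered (CostructuredArrow (h ⋙ Ind.yoneda) Y) :=
    .of_exists_of_isFiltered_of_fullyFaithful pre hpre'
  have : pre.Final := Functor.final_of_exists_of_isFiltered_of_fullyFaithful pre hpre'
  have : FinallySmall.{v} (CostructuredArrow (h ⋙ Ind.yoneda) Y) := by
    refine finallySmall_of_small_weakly_terminal_set
      (Set.range fun i ↦ CostructuredArrow.mk (S := h ⋙ Ind.yoneda) (p i)) fun k ↦ ?_
    obtain ⟨i, ⟨g⟩⟩ := hpre (pre.obj k)
    exact ⟨_, ⟨i, rfl⟩, ⟨pre.preimage g⟩⟩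
  let J := FinallySmall.fromFilteredFinalModel.{v} (CostructuredArrow (h ⋙ Ind.yoneda) Y)
  have hY := (Functor.denseAt Ind.yoneda Y).precompOfFinal h
  exact (mem_essImage_indMap_iff h Y).2 ⟨_, _, inferInstance, J ⋙ CostructuredArrow.proj _ Y, _,
    ⟨(Functor.Final.isColimitWhiskerEquiv J _).symm hY⟩⟩

end EssentialImage

section EpiOntoCompact

theorem exists_epi_of_epi {B : Type u} [Category.{v} B] [Abelian B] {Y : Ind B} {c : B}
    (q : Y ⟶ Ind.yoneda.obj c) [Epi q] :
    ∃ (b : B) (t : Ind.yoneda.obj b ⟶ Y) (e : b ⟶ c), Epi e ∧ t ≫ q = Ind.yoneda.map e := by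
  obtain ⟨K, _, _, G, a, ⟨ha⟩⟩ := exists_colimit_presentation Y
  obtain ⟨ψ, hψ⟩ : ∃ ψ : G ⟶ (Functor.const K).obj c, ∀ k,
      Ind.yoneda.map (ψ.app k) = a.app k ≫ q := by
    exact ⟨{
      app k := Ind.yoneda.preimage (a.app k ≫ q)
      naturality _ _ f := Ind.yoneda.map_injective (by simpa using a.naturality_assoc f q) },
      fun k ↦ Ind.yoneda.map_preimage _⟩
  let π : (Functor.const K).obj c ⟶ cokernel ψ := cokernel.π ψ
  have hπ (k : K) : ψ.app k ≫ π.app k = 0 := congr_app (cokernel.condition ψ) k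
  have : IsConnected K := IsFiltered.isConnected K
  obtain ⟨ρ, hρ⟩ : ∃ ρ : Ind.yoneda.obj c ⟶ colimit (cokernel ψ ⋙ Ind.yoneda), ∀ k,
      ρ = Ind.yoneda.map (π.app k) ≫ colimit.ι (cokernel ψ ⋙ Ind.yoneda) k := by
    obtain ⟨ρ, hρ⟩ := (Functor.const K).map_surjective (X := Ind.yoneda.obj c)
      ((Functor.constComp K c Ind.yoneda).inv ≫ Functor.whiskerRight π Ind.yoneda ≫
        (colimit.cocone (cokernel ψ ⋙ Ind.yoneda)).ι)
    exact ⟨ρ, fun k ↦ by simpa using congr_app hρ k⟩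
  have hρ₀ : ρ = 0 := by
    rw [← cancel_epi q, comp_zero]
    refine ha.hom_ext fun k ↦ ?_
    change a.app k ≫ q ≫ ρ = a.app k ≫ 0
    rw [hρ k, ← Category.assoc, ← hψ, ← Functor.map_comp_assoc, hπ, Functor.map_zero, zero_comp,
      comp_zero]
  obtain ⟨k₀⟩ : Nonempty K := IsFiltered.nonempty
  obtain ⟨k, f, _, hf⟩ := exists_comp_map_eq.{v, v} (colimit.isColimit (cokernel ψ ⋙ Ind.yoneda))
    (s := π.app k₀) (t := (0 : c ⟶ (cokernel ψ).obj k₀))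
      (by rw [Functor.map_zero, zero_comp]; exact (hρ k₀).symm.trans hρ₀)
  have hk : π.app k = 0 := by simpa [hf] using π.naturality f
  exact ⟨_, a.app k, ψ.app k,
    ((ShortComplex.exact_cokernel ψ).map ((evaluation K B).obj k)).epi_f hk, (hψ k).symm⟩

end EpiOntoCompact

section IndExtensions

theorem exists_isColimit_of_isPushout {J : Type*} [Category* J] [IsConnected J] {D : Type*}
    [Category* D] {H Q : J ⥤ D} {X : D} {a : H ⟶ (Functor.const J).obj X}
    (ha : IsColimit (Cocone.mk X a)) {N b P : D} {β : N ⟶ b} {g : N ⟶ X} {inl : b ⟶ P}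
    {inr : X ⟶ P} (hP : IsPushout β g inl inr) {φ : ∀ j, N ⟶ H.obj j}
    {i : (Functor.const J).obj b ⟶ Q} {m : H ⟶ Q}
    (hQ : ∀ j, IsPushout β (φ j) (i.app j) (m.app j)) (hφ : ∀ j, φ j ≫ a.app j = g) :
    ∃ p : Q ⟶ (Functor.const J).obj P, Nonempty (IsColimit (Cocone.mk P p)) := by
  have hw (j : J) : β ≫ inl = φ j ≫ a.app j ≫ inr := by rw [hP.w, reassoc_of% hφ j]
  let p (j : J) : Q.obj j ⟶ P := (hQ j).desc inl (a.app j ≫ inr) (hw j)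
  have hip (j : J) : i.app j ≫ p j = inl := (hQ j).inl_desc _ _ _
  have hmp (j : J) : m.app j ≫ p j = a.app j ≫ inr := (hQ j).inr_desc _ _ _
  have hi {j j' : J} (f : j ⟶ j') : i.app j ≫ Q.map f = i.app j' := by
    simp [← i.naturality f]
  have hp {j j' : J} (f : j ⟶ j') : Q.map f ≫ p j' = p j := (hQ j).hom_ext
    (by rw [reassoc_of% hi f, hip, hip])
    (by simp [hmp, ← m.naturality_assoc])
  refine ⟨{ app := p, naturality _ _ f := by simp [hp f] }, ⟨?_⟩⟩
  have hdesc (s : Cocone Q) : ∃ d : P ⟶ s.pt, ∀ j, p j ≫ d = s.ι.app j := by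
    obtain ⟨y, hy⟩ := (Functor.const J).map_surjective (i ≫ s.ι)
    have hy (j : J) : y = i.app j ≫ s.ι.app j := congr_app hy j
    let x : X ⟶ s.pt := ha.desc (Cocone.mk s.pt (m ≫ s.ι))
    have hx (j : J) : a.app j ≫ x = m.app j ≫ s.ι.app j := ha.fac _ j
    have hyx : β ≫ y = g ≫ x := by
      obtain ⟨j⟩ : Nonempty J := inferInstance
      rw [hy j, ← hφ j, Category.assoc, hx, (hQ j).w_assoc]
    refine ⟨hP.desc y x hyx, fun j ↦ (hQ j).hom_ext ?_ ?_⟩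
    · rw [reassoc_of% hip j, hP.inl_desc, hy j]
    · rw [reassoc_of% hmp j, hP.inr_desc, hx j]
  choose d hd using hdesc
  refine { desc := d, fac := hd, uniq s t ht := hP.hom_ext ?_ (ha.hom_ext fun j ↦ ?_) }
  · obtain ⟨j⟩ : Nonempty J := inferInstance
    rw [← hip j, Category.assoc, Category.assoc, hd, ← ht]
  · change a.app j ≫ inr ≫ t = a.app j ≫ inr ≫ d s
    rw [← reassoc_of% hmp j, ← reassoc_of% hmp j, hd, ← ht]

variable {B : Type u₁} [Category.{max u v} B] [Abelian B]

theorem exists_isColimit_of_shortExact {K : Type v} [SmallCategory K] [IsFiltered K] {G : K ⥤ B}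
    {X Y : Ind B} {a : G ⋙ Ind.yoneda ⟶ (Functor.const K).obj X} (ha : IsColimit (Cocone.mk X a))
    {c : B} {f : X ⟶ Y} {q : Y ⟶ Ind.yoneda.obj c} {w : f ≫ q = 0}
    (hS : (ShortComplex.mk f q w).ShortExact) :
    ∃ (k₀ : K) (Q : Under k₀ ⥤ B) (p : Q ⋙ Ind.yoneda ⟶ (Functor.const _).obj Y),
      Nonempty (IsColimit (Cocone.mk Y p)) ∧ ∀ j : Under k₀,
        ∃ (i : G.obj j.right ⟶ Q.obj j) (r : Q.obj j ⟶ c) (w : i ≫ r = 0),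
          (ShortComplex.mk i r w).ShortExact := by
  have : Mono f := hS.mono_f
  have : Epi q := hS.epi_g
  obtain ⟨b, t, e, _, ht⟩ := exists_epi_of_epi q
  have he := shortExact_kernelSequence e
  obtain ⟨m, hm⟩ := hS.exact.lift' (Ind.yoneda.map (kernel.ι e) ≫ t)
    (by simp [ht, ← Functor.map_comp])
  have hY : IsPushout (Ind.yoneda.map (kernel.ι e)) m t f :=
    isPushout_of_shortExact ⟨hm.symm⟩ (he.map_of_exact Ind.yoneda) hS ht
  obtain ⟨k₀, φ, hφ⟩ := exists_map_yoneda_comp_eq.{v, u} ha m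
  let Φ : (Functor.const _).obj (kernel e) ⟶ Under.forget k₀ ⋙ G :=
    { app j := φ ≫ G.map j.hom
      naturality _ _ f := by simp [← G.map_comp] }
  have hQ := IsPushout.of_hasPushout ((Functor.const (Under k₀)).map (kernel.ι e)) Φ
  have hQ (j : Under k₀) := hQ.map ((evaluation _ _).obj j)
  have : IsConnected (Under k₀) := IsFiltered.isConnected _
  obtain ⟨p, hp⟩ := exists_isColimit_of_isPushout
    ((Functor.Final.isColimitWhiskerEquiv (Under.forget k₀) _).symm ha) hY
    (i := (Functor.constComp _ _ _).inv ≫ Functor.whiskerRight (pushout.inl _ Φ) Ind.yoneda)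
    (m := Functor.whiskerRight (pushout.inr _ Φ) Ind.yoneda)
    (φ := fun j ↦ Ind.yoneda.map (Φ.app j))
    (fun j ↦ by simpa using (hQ j).map Ind.yoneda) fun j ↦ by
      simpa [Φ, ← hφ] using congr(Ind.yoneda.map φ ≫ $(a.naturality j.hom))
  exact ⟨k₀, _, p, hp, fun j ↦ ⟨_, _, _, shortExact_of_isPushout (hQ j) he⟩⟩

variable {A : Type u} [Category.{v} A]

theorem isClosedUnderExtensions_indMap (h : A ⥤ B) [h.Full] [h.Faithful]
    [h.essImage.IsClosedUnderExtensions] : (indMap h).essImage.IsClosedUnderExtensions := by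
  refine ⟨fun {S} hS hX hZ ↦ ?_⟩
  obtain @⟨X, Y, Z, f, q, w⟩ := S
  obtain ⟨KX, _, _, PX, a, ⟨ha⟩⟩ := (mem_essImage_indMap_iff h X).1 hX
  obtain ⟨KZ, _, _, PZ, z, ⟨hz⟩⟩ := (mem_essImage_indMap_iff h Z).1 hZ
  choose k₀ Q p hp hQ using fun i ↦ exists_isColimit_of_shortExact ha
    (shortExact_of_isPullback (IsPullback.of_hasPullback q (z.app i)) hS)
  have hQA (x : Σ i, Under (k₀ i)) : h.essImage ((Q x.1).obj x.2) := by
    obtain ⟨i, r, w, hr⟩ := hQ x.1 x.2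
    exact h.essImage.prop_X₂_of_shortExact hr (h.obj_mem_essImage _) (h.obj_mem_essImage _)
  choose y ey using hQA
  refine mem_essImage_indMap h y (fun x ↦ Ind.yoneda.map (ey x).some.hom ≫ (p x.1).app x.2 ≫
    pullback.fst q (z.app x.1)) fun b t ↦ ?_
  obtain ⟨i, s, hs⟩ := exists_map_yoneda_comp_eq.{v, u} hz (t ≫ q)
  obtain ⟨j, g, hg⟩ := exists_map_yoneda_comp_eq.{v, u} (hp i).some (pullback.lift t _ hs.symm)
  refine ⟨⟨i, j⟩, g ≫ (ey ⟨i, j⟩).some.inv, ?_⟩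
  simpa [← Functor.map_comp_assoc, reassoc_of% hg] using pullback.lift_fst _ _ _

end IndExtensions

theorem additive_of_jointly_mono {A : Type*} [Category* A] [Preadditive A] {B : Type*} [Category* B]
    [Preadditive B] {G : A ⥤ B} {ι : Type*} {H : ι → A ⥤ B} [∀ i, (H i).Additive]
    (φ : ∀ i, G ⟶ H i)
    (hφ : ∀ {a : A} {T : B} (x y : T ⟶ G.obj a), (∀ i, x ≫ (φ i).app a = y ≫ (φ i).app a) → x = y) :
    G.Additive where
  map_add := hφ _ _ fun i ↦ by simp [Functor.map_add]

theorem isSheafFor_singleton_iff_of_isLimit {A : Type u} [Category.{v} A] [Preadditive A]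
    (G : Aᵒᵖ ⥤ AddCommGrpCat.{w}) [G.Additive] {S : ShortComplex A}
    (hS : IsLimit (KernelFork.ofι S.f S.zero)) :
    (Presieve.singleton S.g).IsSheafFor (G ⋙ forget AddCommGrpCat) ↔
      Function.Injective (G.map S.g.op) ∧ Function.Exact (G.map S.g.op) (G.map S.f.op) := by
  have map_comp {a b c : A} (f : a ⟶ b) (g : b ⟶ c) (x : G.obj (op c)) :
      G.map (f ≫ g).op x = G.map f.op (G.map g.op x) := by simp
  have compatible_iff (x : G.obj (op S.X₂)) :
      (∀ {Z : A} (p q : Z ⟶ S.X₂), p ≫ S.g = q ≫ S.g → G.map p.op x = G.map q.op x) ↔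
        G.map S.f.op x = 0 := by
    refine ⟨fun h ↦ by simpa using h S.f 0 (by simp), fun h Z p q hpq ↦ ?_⟩
    obtain ⟨l, hl : l ≫ S.f = p - q⟩ := KernelFork.IsLimit.lift' hS (p - q) (by simp [hpq])
    rw [sub_eq_iff_eq_add.1 hl.symm, op_add, G.map_add]
    change G.map (l ≫ S.f).op x + _ = _
    rw [map_comp, h, map_zero, zero_add]
  refine ⟨fun h ↦ ⟨Presieve.isSeparatedFor_singleton.1 h.isSeparatedFor, fun x ↦ ⟨fun hx ↦ ?_, ?_⟩⟩,
    fun ⟨injective, exact⟩ ↦ Presieve.isSheafFor_singleton.2 fun x hx ↦ ?_⟩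
  · exact (Presieve.isSheafFor_singleton.1 h x ((compatible_iff x).2 hx)).exists
  · rintro ⟨y, rfl⟩
    simp [← map_comp]
  · obtain ⟨y, hy⟩ := (exact x).1 ((compatible_iff x).1 hx)
    exact ⟨y, hy, fun y' hy' ↦ injective (hy'.trans hy.symm)⟩

namespace SequenceClass

variable {A : Type u} [Category.{v} A] [Preadditive A] {E : SequenceClass A} (hE : E.IsExact)

include hE in
theorem IsExact.admissibleEpi_id (a : A) : E.AdmissibleEpi (𝟙 a) := by
  have := hE.hasFiniteBiproducts
  have : HasZeroObject A := hasZeroObject_of_hasTerminal_object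
  let b : BinaryBicone (⊤_ A) a :=
    { pt := a, fst := 0, snd := 𝟙 a, inl := 0, inr := 𝟙 a
      inl_fst := terminalIsTerminal.hom_ext _ _ }
  exact ⟨⊤_ A, _, _, hE.split b ⟨isBinaryBilimitOfTotal b (by simp [b])⟩⟩

/-- The topology whose covering sieves are those containing an admissible epimorphism. -/
def IsExact.topology : GrothendieckTopology A where
  sieves c := {S | ∃ (b : A) (j : b ⟶ c), E.AdmissibleEpi j ∧ S j}
  top_mem' c := ⟨c, 𝟙 c, hE.admissibleEpi_id c, trivial⟩
  pullback_stable' c d S f := by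
    rintro ⟨b, j, hj, hS⟩
    obtain ⟨b', j', f', h, hj'⟩ := hE.pullback_epi j f hj
    refine ⟨b', j', hj', ?_⟩
    rw [Sieve.pullback_apply, ← h.w]
    exact S.downward_closed hS f'
  transitive' c S := by
    rintro ⟨b, j, hj, hS⟩ R hR
    obtain ⟨b', j', hj', hR'⟩ := hR hS
    exact ⟨b', j' ≫ j, hE.comp_epi _ _ hj' hj, hR'⟩

theorem IsExact.isSheaf_topology_iff (P : Aᵒᵖ ⥤ Type w) :
    Presieve.IsSheaf hE.topology P ↔ ∀ ⦃b c : A⦄ (j : b ⟶ c), E.AdmissibleEpi j →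
      (Presieve.singleton j).IsSheafFor P := by
  refine ⟨fun h b c j hj ↦ (Presieve.isSheafFor_iff_generate _).2
    (h _ ⟨b, j, hj, Sieve.le_generate _ _ _ (Presieve.singleton_self _)⟩), ?_⟩
  rintro h c S ⟨b, j, hj, hS⟩ x hx
  obtain ⟨t, ht : P.map j.op t = x j hS, unique⟩ :=
    Presieve.isSheafFor_singleton.1 (h j hj) (x j hS) fun p₁ p₂ hp ↦ hx p₁ p₂ hS hS hp
  refine ⟨t, fun d g hg ↦ ?_, fun t' ht' ↦ unique t' (ht' j hS)⟩
  obtain ⟨b', j', f', hP, hj'⟩ := hE.pullback_epi j g hj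
  refine Presieve.isSeparatedFor_singleton.1 (h j' hj').isSeparatedFor ?_
  calc P.map j'.op (P.map g.op t) = P.map f'.op (P.map j.op t) := by
        simp only [← ConcreteCategory.comp_apply, ← P.map_comp, ← op_comp, hP.w]
    _ = P.map f'.op (x j hS) := by rw [ht]
    _ = P.map j'.op (x g hg) := hx f' j' hS hg hP.w

theorem IsExact.leftExact_iff_isSheaf (G : Aᵒᵖ ⥤ AddCommGrpCat.{max u v}) [G.Additive] :
    E.leftExact G ↔ Presheaf.IsSheaf hE.topology G := by
  rw [Presheaf.isSheaf_iff_isSheaf_forget hE.topology G (forget AddCommGrpCat.{max u v}),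
    isSheaf_iff_isSheaf_of_type, hE.isSheaf_topology_iff]
  have singleton_iff {S : ShortComplex A} (hS : E.mem S) :=
    isSheafFor_singleton_iff_of_isLimit G (E.isKernelCokernelPair hS).1.some
  constructor
  · rintro ⟨-, h⟩ b c j ⟨a, i, w, hij⟩
    exact (singleton_iff hij).2 (h _ hij)
  · exact fun h ↦ ⟨inferInstance, fun S hS ↦ (singleton_iff hS).1 (h _ ⟨_, _, _, hS⟩)⟩

theorem IsExact.injective_map_of_admissibleEpi (G : Sheaf hE.topology AddCommGrpCat.{max u v})
    {b c : A} {j : b ⟶ c} (hj : E.AdmissibleEpi j) : Function.Injective (G.obj.map j.op) := by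
  have hG := (Presheaf.isSheaf_iff_isSheaf_forget hE.topology G.obj
    (forget AddCommGrpCat.{max u v})).1 G.property
  rw [isSheaf_iff_isSheaf_of_type, hE.isSheaf_topology_iff] at hG
  exact Presieve.isSeparatedFor_singleton.1 (hG j hj).isSeparatedFor

theorem IsExact.exists_admissibleEpi_of_epi {G H : Sheaf hE.topology AddCommGrpCat.{max u v}}
    (f : G ⟶ H) [Epi f] {c : A} (x : H.obj.obj (op c)) :
    ∃ (b : A) (j : b ⟶ c) (_ : E.AdmissibleEpi j) (y : G.obj.obj (op b)),
      f.hom.app (op b) y = H.obj.map j.op x := by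
  have := (Sheaf.isLocallySurjective_iff_epi' (φ := f)).2 inferInstance
  obtain ⟨b, j, hj, y, hy⟩ := Presheaf.imageSieve_mem hE.topology f.hom x
  exact ⟨b, j, hj, y, hy⟩

/-- The additive sheaves of abelian groups. They will turn out to be the objects of the abelian
envelope. -/
def IsExact.additiveSheaf : ObjectProperty (Sheaf hE.topology AddCommGrpCat.{max u v}) :=
  fun G ↦ G.obj.Additive

instance : hE.additiveSheaf.IsClosedUnderSubobjects where
  prop_of_mono {G H} f hf h := by
    have : H.obj.Additive := h
    have : Mono f.hom := inferInstanceAs (Mono ((sheafToPresheaf _ _).map f))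
    exact additive_of_jointly_mono (ι := Unit) (fun _ ↦ f.hom) fun x y hxy ↦
      (cancel_mono _).1 (hxy ())

instance : hE.additiveSheaf.IsClosedUnderQuotients where
  prop_of_epi {G H} f hf h := by
    have : G.obj.Additive := h
    refine ⟨fun {c d p q} ↦ ?_⟩
    ext x
    obtain ⟨b, j, hj, y, hy⟩ := hE.exists_admissibleEpi_of_epi (c := c.unop) f x
    obtain ⟨d₁, j₁, p', hp, hj₁⟩ := hE.pullback_epi j p.unop hj
    obtain ⟨d₂, j₂, q', hq, hj₂⟩ := hE.pullback_epi j (j₁ ≫ q.unop) hj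
    refine hE.injective_map_of_admissibleEpi H (hE.comp_epi _ _ hj₂ hj₁) ?_
    have map_eq {r : d₂ ⟶ b} {s : d.unop ⟶ c.unop} (h : r ≫ j = (j₂ ≫ j₁) ≫ s) :
        H.obj.map (j₂ ≫ j₁).op (H.obj.map s.op x) = f.hom.app _ (G.obj.map r.op y) := by
      rw [NatTrans.naturality_apply, hy, ← ConcreteCategory.comp_apply, ← Functor.map_comp,
        ← op_comp, ← h, op_comp, Functor.map_comp, ConcreteCategory.comp_apply]
    have hp' : (j₂ ≫ p') ≫ j = (j₂ ≫ j₁) ≫ p.unop := by simp [hp.w]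
    have hq' : q' ≫ j = (j₂ ≫ j₁) ≫ q.unop := by simp [hq.w]
    have hpq : (j₂ ≫ p' + q') ≫ j = (j₂ ≫ j₁) ≫ (p.unop + q.unop) := by
      rw [Preadditive.add_comp, hp', hq', Preadditive.comp_add]
    refine (map_eq hpq).trans ?_
    rw [op_add, G.obj.map_add]
    change f.hom.app _ (G.obj.map (j₂ ≫ p').op y + G.obj.map q'.op y) =
      H.obj.map (j₂ ≫ j₁).op (H.obj.map p.unop.op x + H.obj.map q.unop.op x)
    rw [map_add, map_add, map_eq hp', map_eq hq']

instance : hE.additiveSheaf.IsClosedUnderFiniteProducts where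
  isClosedUnderLimitsOfShape J _ := by
    refine ⟨?_⟩
    rintro G ⟨p⟩
    have (j : Discrete J) : (p.diag.obj j).obj.Additive := p.prop_diag_obj j
    refine additive_of_jointly_mono (fun j ↦ (p.π.app j).hom) fun {a T} x y hxy ↦ ?_
    exact (isLimitOfPreserves (sheafToPresheaf _ _ ⋙ (evaluation _ _).obj a) p.isLimit).hom_ext hxy

instance : hE.additiveSheaf.ContainsZero where
  exists_zero := ⟨⊤_ _, (isZero_zero _).of_iso HasZeroObject.zeroIsoTerminal.symm,
    hE.additiveSheaf.prop_of_isLimit (limit.isLimit (Functor.empty.{0} _)) fun ⟨j⟩ ↦ j.elim⟩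

/-- The inclusion of the abelian envelope into all sheaves, the identity on underlying
presheaves. -/
def IsExact.envelopeToSheaf : E.Envelope ⥤ Sheaf hE.topology AddCommGrpCat.{max u v} :=
  ObjectProperty.lift _ E.leftExact.ι fun G ↦
    have : G.obj.Additive := G.property.1
    (hE.leftExact_iff_isSheaf G.obj).1 G.property

instance : hE.envelopeToSheaf.Full := by
  unfold IsExact.envelopeToSheaf; infer_instance

instance : hE.envelopeToSheaf.Faithful := by
  unfold IsExact.envelopeToSheaf; infer_instance

theorem IsExact.additiveSheaf_envelopeToSheaf (G : E.Envelope) :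
    hE.additiveSheaf (hE.envelopeToSheaf.obj G) :=
  G.property.1

/-- The abelian envelope as the category of additive sheaves. -/
def IsExact.envelopeToAdditiveSheaf : E.Envelope ⥤ hE.additiveSheaf.FullSubcategory :=
  hE.additiveSheaf.lift hE.envelopeToSheaf hE.additiveSheaf_envelopeToSheaf

instance : hE.envelopeToAdditiveSheaf.Full := by
  unfold IsExact.envelopeToAdditiveSheaf; infer_instance

instance : hE.envelopeToAdditiveSheaf.Faithful := by
  unfold IsExact.envelopeToAdditiveSheaf; infer_instance

instance : hE.envelopeToAdditiveSheaf.EssSurj where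
  mem_essImage G :=
    have : G.obj.obj.Additive := G.property
    ⟨⟨G.obj.obj, (hE.leftExact_iff_isSheaf G.obj.obj).2 G.obj.property⟩, ⟨Iso.refl _⟩⟩

instance : hE.envelopeToAdditiveSheaf.IsEquivalence where

/-- The abelian envelope is abelian, by transport from additive sheaves. It is not an instance
because it depends on the exactness `hE` of `E`. -/
@[reducible]
noncomputable def IsExact.envelopeAbelian : Abelian E.Envelope :=
  have : HasFiniteProducts E.Envelope :=
    ⟨fun _ ↦ Adjunction.hasLimitsOfShape_of_equivalence hE.envelopeToAdditiveSheaf⟩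
  abelianOfEquivalence hE.envelopeToAdditiveSheaf

include hE in
theorem IsExact.exists_admissibleEpi_of_epi_envelope {G H : E.Envelope} (f : G ⟶ H) [Epi f] {c : A}
    (x : H.obj.obj (op c)) :
    ∃ (b : A) (j : b ⟶ c) (_ : E.AdmissibleEpi j) (y : G.obj.obj (op b)),
      f.hom.app (op b) y = H.obj.map j.op x :=
  have := hE.additiveSheaf.preservesEpimorphisms_ι_of_isNormalMonoCategory
  hE.exists_admissibleEpi_of_epi ((hE.envelopeToAdditiveSheaf ⋙ hE.additiveSheaf.ι).map f) x

end SequenceClass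

namespace SequenceClass

variable {A : Type u} [Category.{v} A] [Preadditive A] {E : SequenceClass A}

/-- The Yoneda lemma for additive functors. -/
def yonedaUliftEquiv (G : Aᵒᵖ ⥤ AddCommGrpCat.{max u v}) [G.Additive] (c : A) :
    (yonedaUlift.obj c ⟶ G) ≃ G.obj (op c) where
  toFun t := t.app (op c) ⟨𝟙 c⟩
  invFun y :=
    { app d := AddCommGrpCat.ofHom (AddMonoidHom.mk' (fun g : ULift.{u} (d.unop ⟶ c) ↦
        G.map g.down.op y) fun g g' ↦ congr($(G.map_add (f := g.down.op) (g := g'.down.op)) y))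
      naturality _ _ f := by
        ext g
        exact congr($(G.map_comp (show _ ⟶ c from g.down).op f) y) }
  left_inv t := by
    ext d g
    refine (NatTrans.naturality_apply t (show d.unop ⟶ c from g.down).op ⟨𝟙 c⟩).symm.trans ?_
    exact congr(t.app d ⟨$(Category.comp_id (show d.unop ⟶ c from g.down))⟩)
  right_inv y := congr($(G.map_id (op c)) y)

theorem yonedaUliftEquiv_map_comp {G : Aᵒᵖ ⥤ AddCommGrpCat.{max u v}} [G.Additive] {b c : A}
    (g : b ⟶ c) (t : yonedaUlift.obj c ⟶ G) :
    yonedaUliftEquiv G b (yonedaUlift.map g ≫ t) = G.map g.op (yonedaUliftEquiv G c t) := by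
  refine Eq.trans ?_ (NatTrans.naturality_apply t g.op ⟨𝟙 c⟩)
  exact congr(t.app (op b) ⟨$((Category.id_comp g).trans (Category.comp_id g).symm)⟩)

instance : PreservesFiniteLimits (yonedaUlift (A := A)) where
  preservesFiniteLimits J _ _ := preservesLimitsOfShape_of_evaluation _ _ fun d ↦
    preservesLimitsOfShape_of_natIso (F := preadditiveCoyoneda.obj d ⋙ AddCommGrpCat.uliftFunctor)
      (NatIso.ofComponents fun _ ↦ Iso.refl _)

instance : PreservesFiniteLimits E.quillenEmbedding :=
  have : PreservesFiniteLimits (E.quillenEmbedding ⋙ E.leftExact.ι) :=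
    inferInstanceAs (PreservesFiniteLimits yonedaUlift)
  preservesFiniteLimits_of_reflects_of_preserves _ E.leftExact.ι

theorem epi_quillenEmbedding_map {b c : A} {j : b ⟶ c} (hj : E.AdmissibleEpi j) :
    Epi (E.quillenEmbedding.map j) where
  left_cancellation {G} s t hst := by
    obtain ⟨a, i, w, hij⟩ := hj
    have : G.obj.Additive := G.property.1
    refine ObjectProperty.hom_ext _ ((yonedaUliftEquiv G.obj c).injective
      ((G.property.2 _ hij).1 ?_))
    refine (yonedaUliftEquiv_map_comp j s.hom).symm.trans ?_
    exact congr(yonedaUliftEquiv G.obj b ($hst).hom).trans (yonedaUliftEquiv_map_comp j t.hom)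

variable (hE : E.IsExact)

include hE

theorem IsExact.shortExact_map_quillenEmbedding {S : ShortComplex A} (hS : E.mem S) :
    letI := hE.envelopeAbelian
    (S.map E.quillenEmbedding).ShortExact := by
  let := hE.envelopeAbelian
  obtain ⟨⟨hker⟩, -⟩ := E.isKernelCokernelPair hS
  have hker' := (KernelFork.isLimitMapConeEquiv _ E.quillenEmbedding)
    (isLimitOfPreserves E.quillenEmbedding hker)
  exact
  { exact := ShortComplex.exact_of_f_is_kernel _ hker'
    mono_f := mono_of_isLimit_fork hker'
    epi_g := epi_quillenEmbedding_map ⟨_, S.f, S.zero, hS⟩ }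

theorem IsExact.exists_admissibleEpi_fac_of_epi {G : E.Envelope} {c : A}
    (q : G ⟶ E.quillenEmbedding.obj c) [Epi q] :
    ∃ (b : A) (j : b ⟶ c) (_ : E.AdmissibleEpi j) (m : E.quillenEmbedding.obj b ⟶ G),
      m ≫ q = E.quillenEmbedding.map j := by
  have : G.obj.Additive := G.property.1
  have : (yonedaUlift.obj c).Additive := (E.leftExact_yonedaUlift c).1
  obtain ⟨b, j, hj, y, hy⟩ :=
    hE.exists_admissibleEpi_of_epi_envelope q (yonedaUliftEquiv (yonedaUlift.obj c) c (𝟙 _))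
  let t := (yonedaUliftEquiv G.obj b).symm y
  have ht : yonedaUliftEquiv G.obj b t = y := Equiv.apply_symm_apply _ _
  have htq : yonedaUliftEquiv (yonedaUlift.obj c) b (t ≫ q.hom) =
      yonedaUliftEquiv (yonedaUlift.obj c) b (yonedaUlift.map j ≫ 𝟙 _) :=
    (congr(q.hom.app (op b) $ht).trans hy).trans (yonedaUliftEquiv_map_comp j (𝟙 _)).symm
  refine ⟨b, j, hj, ObjectProperty.homMk t, ObjectProperty.hom_ext _ ?_⟩
  exact (Equiv.injective _ htq).trans (Category.comp_id _)

theorem IsExact.exists_isPushout_mem {a b c x : A} {i : a ⟶ b} {j : b ⟶ c} {w : i ≫ j = 0}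
    (hij : E.mem (.mk i j w)) (φ : a ⟶ x) :
    ∃ (d : A) (i' : x ⟶ d) (f' : b ⟶ d) (hP : IsPushout i φ f' i'),
      E.mem (.mk i' (hP.desc j 0 (by simp [w])) (by simp)) := by
  obtain ⟨d, i', f', hP, e, l, w', hl⟩ := hE.pushout_mono i φ ⟨_, j, w, hij⟩
  obtain ⟨-, ⟨hj⟩⟩ := E.isKernelCokernelPair hij
  obtain ⟨-, ⟨hl'⟩⟩ := E.isKernelCokernelPair hl
  refine ⟨d, i', f', hP, ?_⟩
  have : Epi j := epi_of_isColimit_cofork hj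
  have : Epi (hP.desc j 0 (by simp [w])) := epi_of_epi_fac (hP.inl_desc j 0 (by simp [w]))
  have hdesc : IsColimit (CokernelCofork.ofπ (hP.desc j 0 (by simp [w]))
      (by simp : i' ≫ _ = 0)) := CokernelCofork.IsColimit.ofπ' _ _ fun t ht ↦ by
    let s := CokernelCofork.IsColimit.desc' hj (f' ≫ t) (by simp [hP.w_assoc, ht])
    exact ⟨s.1, hP.hom_ext (by simpa using s.2) (by simp [ht])⟩
  let α : e ≅ c := hl'.coconePointUniqueUpToIso hdesc
  have hα : l ≫ α.hom = hP.desc j 0 (by simp [w]) :=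
    hl'.comp_coconePointUniqueUpToIso_hom hdesc .one
  refine hE.of_iso ⟨ShortComplex.isoMk (S₁ := .mk i' l w') (Iso.refl _) (Iso.refl _) α
    (by simp) (by simp [hα])⟩ hl

theorem IsExact.isClosedUnderExtensions_quillenEmbedding :
    E.quillenEmbedding.essImage.IsClosedUnderExtensions := by
  let := hE.envelopeAbelian
  refine ⟨fun {S} hS ⟨a, ⟨e₁⟩⟩ ⟨c, ⟨e₃⟩⟩ ↦ ?_⟩
  let h := E.quillenEmbedding
  have hS' : (ShortComplex.mk (e₁.hom ≫ S.f) (S.g ≫ e₃.inv) (by simp)).ShortExact :=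
    ShortComplex.shortExact_of_iso (ShortComplex.isoMk e₁.symm (Iso.refl _) e₃.symm) hS
  have : Epi (S.g ≫ e₃.inv) := hS'.epi_g
  have : Mono (e₁.hom ≫ S.f) := hS'.mono_f
  obtain ⟨b, j, ⟨x, i, w, hij⟩, m, hm⟩ := hE.exists_admissibleEpi_fac_of_epi (S.g ≫ e₃.inv)
  obtain ⟨φ, hφ⟩ : ∃ φ : x ⟶ a, h.map φ ≫ e₁.hom ≫ S.f = h.map i ≫ m := by
    have hk : (h.map i ≫ m) ≫ S.g ≫ e₃.inv = 0 := by
      rw [Category.assoc, hm, ← h.map_comp, w, h.map_zero]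
    exact ⟨h.preimage (hS'.exact.lift _ hk), by
      rw [h.map_preimage]; exact hS'.exact.lift_f _ hk⟩
  obtain ⟨d, i', f', hP, hd⟩ := hE.exists_isPushout_mem hij φ
  have hij' := hE.shortExact_map_quillenEmbedding hij
  have hX₂ := isPushout_of_shortExact ⟨hφ.symm⟩ hij' hS' hm
  have hd' := isPushout_of_shortExact (hP.toCommSq.map h) hij'
    (hE.shortExact_map_quillenEmbedding hd)
    ((h.map_comp _ _).symm.trans congr(h.map $(hP.inl_desc _ _ _)))
  exact ⟨d, ⟨hd'.isoIsPushout _ _ hX₂⟩⟩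

end SequenceClass

namespace SequenceClass

variable {A : Type u} [Category.{v} A] [Preadditive A] {E : SequenceClass A} (hE : E.IsExact)

include hE

theorem IsExact.isClosedUnderExtensions_indMap :
    (indMap E.quillenEmbedding).essImage.IsClosedUnderExtensions :=
  let := hE.envelopeAbelian
  have := hE.isClosedUnderExtensions_quillenEmbedding
  IndPro.isClosedUnderExtensions_indMap E.quillenEmbedding

theorem IsExact.isClosedUnderExtensions_proMap :
    (proMap E.quillenEmbedding).essImage.IsClosedUnderExtensions :=
  let := hE.envelopeAbelian
  have := hE.isClosedUnderExtensions_quillenEmbedding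
  have := isClosedUnderExtensions_op_essImage E.quillenEmbedding
  have := IndPro.isClosedUnderExtensions_indMap E.quillenEmbedding.op
  isClosedUnderExtensions_op_essImage (indMap E.quillenEmbedding.op)

theorem IsExact.ind : E.ind.IsExact := by
  let := hE.envelopeAbelian
  have := hE.hasFiniteBiproducts
  have : HasBinaryBiproducts (Ind A) := HasBinaryBiproducts.of_hasBinaryProducts
  have := hE.isClosedUnderExtensions_indMap
  have := additive_of_fullyFaithful (indMap E.quillenEmbedding)
  exact isExact_of_isClosedUnderExtensions (F := indMap E.quillenEmbedding) fun _ ↦ Iff.rfl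

theorem IsExact.pro : E.pro.IsExact := by
  let := hE.envelopeAbelian
  have := hE.hasFiniteBiproducts
  have : HasFiniteBiproducts Aᵒᵖ := HasFiniteBiproducts.of_hasFiniteProducts
  have : HasFiniteBiproducts (Pro A) := HasFiniteBiproducts.of_hasFiniteProducts
  have : HasBinaryBiproducts (Pro A) := HasBinaryBiproducts.of_hasBinaryProducts
  have := hE.isClosedUnderExtensions_proMap
  have := additive_of_fullyFaithful (proMap E.quillenEmbedding)
  exact isExact_of_isClosedUnderExtensions (F := proMap E.quillenEmbedding) fun _ ↦ Iff.rfl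

end SequenceClass

namespace CatWithSequences

theorem isExact_apply (C : CatWithSequences.{v, u}) (hC : C.seq.IsExact) :
    ∀ s : Step, (C.apply s).seq.IsExact
  | .ind => hC.ind
  | .pro => hC.pro

theorem isExact_iterated (C : CatWithSequences.{v, u}) (hC : C.seq.IsExact) (s : Step) :
    ∀ l : List Step, (C.iterated s l).seq.IsExact
  | [] => C.isExact_apply hC s
  | t :: l => (C.iterated s l).isExact_apply (C.isExact_iterated hC s l) t

end CatWithSequences

end IndPro

theorem mainTheorem5 {A : Type u} [Category.{v} A] [Preadditive A] (E : SequenceClass A)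
    (hE : E.IsExact) :
    -- `Ind(F)` and `Pro(F)` are abelian
    (∃ ab : Abelian (Ind E.Envelope), ab.toPreadditive = indPreadditive) ∧
    (∃ ab : Abelian (Pro E.Envelope),
      ab.toPreadditive = (inferInstance : Preadditive (Pro E.Envelope))) ∧
    -- `Ind(A)` and `Pro(A)` are full subcategories of them, closed under extensions
    ((indMap E.quillenEmbedding).Full ∧ (indMap E.quillenEmbedding).Faithful ∧
      (indMap E.quillenEmbedding).essImage.IsClosedUnderExtensions) ∧
    ((proMap E.quillenEmbedding).Full ∧ (proMap E.quillenEmbedding).Faithful ∧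
      (proMap E.quillenEmbedding).essImage.IsClosedUnderExtensions) ∧
    -- the induced classes of short exact sequences are exact structures
    E.ind.IsExact ∧ E.pro.IsExact ∧
    -- so are the classes obtained by iterating
    ∀ (s : Step) (l : List Step),
      (CatWithSequences.iterated { carrier := A, seq := E } s l).seq.IsExact := by
  let := hE.envelopeAbelian
  exact ⟨⟨indAbelian, rfl⟩, ⟨inferInstanceAs (Abelian (Ind E.Envelopeᵒᵖ)ᵒᵖ), rfl⟩,
    ⟨inferInstance, inferInstance, hE.isClosedUnderExtensions_indMap⟩,
    ⟨inferInstance, inferInstance, hE.isClosedUnderExtensions_proMap⟩, hE.ind, hE.pro,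
    CatWithSequences.isExact_iterated { carrier := A, seq := E } hE⟩
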